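/- **Theorem (Main Theorem).** Graphs are simple and undirected. A *Kazhdan graph structure* $(X,\Gamma)$ is a regular graph $X$ with a subgroup $\Gamma\le\mathrm{Aut}(X)$ having Kazhdan's property (T) (as a discrete group), such that $V(X)/\Gamma$ is finite and all vertex stabilizers $\Gamma_x$ are finite. If $X$ is $k$-regular and $\pi$ is a unitary representation of $\Gamma$ on a complex Hilbert space $\mathcal H$, let $\mathcal E_\pi$ be the space of functions $f:V(X)\to\mathcal H$ with $f(\gamma u)=\pi(\gamma)f(u)$ for all $\gamma\in\Gamma$, $u\in V(X)$, and let $$M_\pi f(u)=\frac1k\sum_{v\sim u}f(v),\qquad f\in\mathcal E_\pi .$$ A real number $\sigma<1$ is called a *Kazhdan constant* of $\Gamma$ (with respect to the simple random walk on $X$) if $\mathrm{spec}(M_\pi)\subseteq[-1,\sigma]\cup\{1\}$ for every unitary representation $\pi$ of $\Gamma$. A map $p:V(X)\to V(Y)$ is a *covering map* if it preserves adjacency and maps the neighbours of each vertex $u$ bijectively onto the neighbours of $p(u)$; $\mathrm{Cov}(p)$ is the group of all $\alpha\in\mathrm{Aut}(X)$ with $p\circ\alpha=p$. A finite $k$-regular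 graph $Y$ with $n$ vertices is an *$(n,k,c)$-expander* if $|\partial A|\ge c\,(1-|A|/n)\,|A|$ for all $A\subseteq V(Y)$, where $\partial A$ is the set of vertices at distance exactly $1$ from $A$. There is a function $\sigma\mapsto c(\sigma)$ with $c(\sigma)>0$ for all $\sigma<1$ such that the following holds for every integer $k\ge 0$ and every Kazhdan graph structure $(X,\Gamma)$ with $X$ connected and $k$-regular. 1. $\Gamma$ has a Kazhdan constant $\sigma<1$ (with respect to the simple random walk on $X$). 2. Let $\sigma$ be any such Kazhdan constant, and let $(X_i)_{i\in I}$ be any family of finite connected $k$-regular graphs with covering maps $p_i:X\to X_i$ such that, for each $i\in I$, either (i) $\Gamma\subseteq\mathrm{Cov}(p_i)$, or (ii) $\mathrm{Cov}(p_i)$ is a subgroup of finite index in $\Gamma$. Then every $X_i$ is a $(|V(X_i)|,k,c(\sigma))$-expander. In particular $(X_i)_{i\in I}$ is a family of expanders, with an expansion constant that depends only on the Kazhdan constant $\sigma$. (When $k=0$, $M_\pi$ is read as $0$.) -/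

import Mathlib

noncomputable section

namespace KazhdanGraph

universe u v

/-! ### Property (T) -/

section PropertyT

variable {G : Type u} [Group G]

/-- A unitary representation of the discrete group `G` on a complex Hilbert space `H` is a
homomorphism from `G` to the group `H ≃ₗᵢ[ℂ] H` of unitary operators. -/
abbrev UnitaryRep (G : Type u) [Group G] (H : Type v) [NormedAddCommGroup H]
    [InnerProductSpace ℂ H] := G →* (H ≃ₗᵢ[ℂ] H)

variable {H : Type v} [NormedAddCommGroup H] [InnerProductSpace ℂ H]

/-- For a finite set `Q`, the vector `ξ` is `(Q, ε)`-invariant if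
`sup_{x ∈ Q} ‖π x ξ - ξ‖ < ε ‖ξ‖`. The condition `ξ ≠ 0` is automatic when `Q` is non-empty
and is what the inequality says (with supremum `0`) when `Q` is empty. -/
def IsInvariantVector (π : UnitaryRep G H) (Q : Finset G) (ε : ℝ) (ξ : H) : Prop :=
  ξ ≠ 0 ∧ ∀ x ∈ Q, ‖π x ξ - ξ‖ < ε * ‖ξ‖

/-- The representation has a non-zero invariant vector. -/
def HasInvariantVector (π : UnitaryRep G H) : Prop :=
  ∃ ξ : H, ξ ≠ 0 ∧ ∀ γ : G, π γ ξ = ξ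

/-- Kazhdan's property (T) for a discrete group. Hilbert spaces in the universe of `G` suffice: a
closed invariant subspace generated by one vector has a dense subset of size at most
`max |G| ℵ₀`, so it is isometric to some `ℓ²(ι)` with `ι` in the universe of `G`. -/
def HasPropertyT (G : Type u) [Group G] : Prop :=
  ∃ (Q : Finset G) (ε : ℝ), 0 < ε ∧
    ∀ (H : Type u) [NormedAddCommGroup H] [InnerProductSpace ℂ H] [CompleteSpace H]
      (π : UnitaryRep G H),
      (∃ ξ : H, IsInvariantVector π Q ε ξ) → HasInvariantVector π

end PropertyT

/-! ### Kazhdan graph structures -/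

section Structure

variable {V : Type u}

/-- A Kazhdan graph structure `(X, Γ)`: a regular graph `X` and a subgroup `Γ` of its automorphism
group, acting with finitely many vertex orbits and finite vertex stabilizers, with
property (T). -/
structure IsKazhdanGraphStructure (X : SimpleGraph V) [X.LocallyFinite]
    (Γ : Subgroup (X ≃g X)) : Prop where
  regular : ∃ d : ℕ, X.IsRegularOfDegree d
  finite_orbits : Finite (MulAction.orbitRel.Quotient Γ V)
  finite_stabilizer : ∀ x : V, Finite (MulAction.stabilizer Γ x)
  propertyT : HasPropertyT Γ

variable {X : SimpleGraph V}
variable {H : Type v} [NormedAddCommGroup H] [InnerProductSpace ℂ H]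

/-- The space `E_π` of `Γ`-equivariant functions `f : V(X) → H`, `f (γ u) = π γ (f u)`. -/
def equivariantFunctions (Γ : Subgroup (X ≃g X)) (π : UnitaryRep Γ H) :
    Submodule ℂ (V → H) where
  carrier := {f | ∀ (γ : Γ) (u : V), f (γ • u) = π γ (f u)}
  add_mem' := by
    intro f g hf hg γ u
    simp [hf γ u, hg γ u]
  zero_mem' := by
    intro γ u
    simp
  smul_mem' := by
    intro c f hf γ u
    simp [hf γ u]

theorem sum_neighbors_smul {E : Type v} [AddCommMonoid E] [X.LocallyFinite]
    (Γ : Subgroup (X ≃g X)) (γ : Γ) (u : V) (f : V → E) :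
    ∑ v ∈ X.neighborFinset (γ • u), f v = ∑ v ∈ X.neighborFinset u, f (γ • v) := by
  symm
  refine Finset.sum_bij (fun v _ => γ • v) ?_ ?_ ?_ ?_
  · intro v hv
    rw [SimpleGraph.mem_neighborFinset] at hv ⊢
    exact (γ : X ≃g X).map_adj_iff.2 hv
  · intro a _ b _ h
    exact MulAction.injective γ h
  · intro w hw
    refine ⟨γ⁻¹ • w, ?_, smul_inv_smul γ w⟩
    rw [SimpleGraph.mem_neighborFinset] at hw ⊢
    apply (γ : X ≃g X).map_adj_iff.1
    change X.Adj (γ • u) (γ • (γ⁻¹ • w))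
    rwa [smul_inv_smul]
  · intro _ _
    rfl

/-- The operator `M_π` on `E_π` of the simple random walk on the `k`-regular graph `X`:
`M_π f (u) = (1/k) ∑_{v ∼ u} f v`. -/
def markovOperator [X.LocallyFinite] (k : ℕ) (Γ : Subgroup (X ≃g X)) (π : UnitaryRep Γ H) :
    Module.End ℂ (equivariantFunctions Γ π) where
  toFun f := ⟨fun u => (1 / (k : ℂ)) • ∑ v ∈ X.neighborFinset u, (f : V → H) v, by
    intro γ u
    have hf : ∀ v, (f : V → H) (γ • v) = π γ ((f : V → H) v) := f.2 γ
    simp only [sum_neighbors_smul, hf, map_smul, map_sum]⟩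
  map_add' f g := by
    ext u
    simp [Finset.sum_add_distrib]
  map_smul' c f := by
    ext u
    simp [← Finset.smul_sum, smul_comm c]

/-- `σ < 1` is a Kazhdan constant of `Γ` (for the simple random walk on the `k`-regular graph `X`)
if `spec(M_π) ⊆ [-1, σ] ∪ {1}` for every unitary representation `π` of `Γ`.

When `Γ` has finitely many vertex orbits, `E_π` is a Hilbert space for
`⟨f, g⟩ = ∑_{u ∈ V(X)/Γ} ⟨f u, g u⟩` and `M_π` is bounded; by the bounded inverse theorem its
spectrum as a bounded operator is its spectrum as a linear endomorphism, i.e. the set of all `z`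
for which `M_π - z` is not bijective, which is the set used here. -/
def IsKazhdanConstant (X : SimpleGraph V) [X.LocallyFinite] (k : ℕ) (Γ : Subgroup (X ≃g X))
    (σ : ℝ) : Prop :=
  σ < 1 ∧
    ∀ (H : Type u) [NormedAddCommGroup H] [InnerProductSpace ℂ H] [CompleteSpace H]
      (π : UnitaryRep Γ H),
      spectrum ℂ (markovOperator k Γ π) ⊆ Complex.ofReal '' (Set.Icc (-1) σ ∪ {1})

end Structure

/-! ### Coverings -/

section Covering

variable {V : Type u} {W : Type v}

/-- `p` is a covering map of graphs: it preserves adjacency and restricts to a bijection from the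
neighbours of `u` onto the neighbours of `p u`, for every vertex `u`. -/
structure IsGraphCovering (X : SimpleGraph V) (Y : SimpleGraph W) (p : V → W) : Prop where
  adj : ∀ u v : V, X.Adj u v → Y.Adj (p u) (p v)
  bijOn : ∀ u : V, Set.BijOn p (X.neighborSet u) (Y.neighborSet (p u))

/-- The group `Cov(p)` of covering transformations: automorphisms `α` of `X` with `p ∘ α = p`. -/
def Cov (X : SimpleGraph V) (p : V → W) : Subgroup (X ≃g X) where
  carrier := {α | p ∘ α = p}
  one_mem' := rfl
  mul_mem' := by
    intro a b ha hb
    funext x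
    exact (congrFun ha (b x)).trans (congrFun hb x)
  inv_mem' := by
    intro a ha
    funext x
    have h := congrFun ha (a⁻¹ x)
    simp only [Function.comp_apply, RelIso.apply_inv_self] at h
    exact h.symm

end Covering

/-! ### Expanders -/

section Expander

variable {W : Type v} [Fintype W]

open Classical in
/-- The vertex boundary `∂A`: the vertices at distance exactly `1` from `A`. -/
def boundary (Y : SimpleGraph W) (A : Finset W) : Finset W :=
  Finset.univ.filter fun y => y ∉ A ∧ ∃ a ∈ A, Y.Adj a y

/-- `Y` is an `(n, d, c)`-expander: it has `n` vertices, is `d`-regular, and satisfies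
`|∂A| ≥ c (1 - |A|/n) |A|` for every set `A` of vertices. -/
structure IsExpander (Y : SimpleGraph W) [Y.LocallyFinite] (n d : ℕ) (c : ℝ) : Prop where
  card_eq : Fintype.card W = n
  regular : Y.IsRegularOfDegree d
  expands : ∀ A : Finset W,
    c * (1 - (A.card : ℝ) / (n : ℝ)) * (A.card : ℝ) ≤ ((boundary Y A).card : ℝ)

end Expander

/-- The finite graphs `Y i` form a family of `d`-regular expanders with expansion
constant `c > 0`. -/
def IsExpanderFamily {ι : Type*} {W : ι → Type*} [∀ i, Fintype (W i)]
    (Y : ∀ i, SimpleGraph (W i)) [∀ i, (Y i).LocallyFinite] (d : ℕ) (c : ℝ) : Prop :=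
  0 < c ∧ ∀ i, IsExpander (Y i) (Fintype.card (W i)) d c

end KazhdanGraph

end

noncomputable section

namespace KazhdanGraph

universe u v

open scoped InnerProductSpace

/-! ### A criterion for a spectral gap -/

section Gap

variable {E : Type*} [NormedAddCommGroup E] [InnerProductSpace ℂ E] [CompleteSpace E]

/-! An equivariant function is determined by its values on finitely many orbit representatives.
Weighting these by inverse stabilizer orders makes `E_π` a Hilbert space on which `M_π` is
symmetric, by mass transport (`orbitSum_sum_neighbor_swap`).

Existence of `σ`: if `f` varies little along edges, equivariance makes `f u₀` almost invariant, so
property (T) puts it near an invariant vector `η`, and `f` is near the constant function `η`. Hence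
functions orthogonal to all such constants satisfy a Poincaré inequality with a constant `N`
independent of `π` (`exists_poincare`). Since the Dirichlet form is `2k(‖f‖² - ⟨M f, f⟩)`, this is a
gap below `1`, with `σ = 1 - 1/(2kN)`.

Expansion: an eigenfunction `φ` on a quotient graph lifts to `x ↦ (γ ↦ φ (p (γ⁻¹ x)))`, an
equivariant map into `ℓ²` of the finite coset space of `Γ ∩ Cov(p)` in `Γ`. Its eigenvalue therefore
lies in some `spec(M_π)` and is at most `σ` or equal to `1` (`mem_spectrum_markovOperator`). By
connectedness the eigenvalue `1` belongs to constants only, so mean-zero functions have gap `1 - σ`.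
Testing on a centred indicator gives expansion with `c(σ) = 1 - σ`. The degenerate case `k = 0` is
treated separately throughout. -/

theorem isUnit_of_isSelfAdjoint_of_bound {S : E →L[ℂ] E} (hS : IsSelfAdjoint S) {c : ℝ}
    (hc : 0 < c) (h : ∀ x, c * ‖x‖ ≤ ‖S x‖) : IsUnit S := by
  rw [ContinuousLinearMap.isUnit_iff_bijective,
    ContinuousLinearMap.bijective_iff_dense_range_and_antilipschitz]
  refine ⟨?_, ⟨⟨c⁻¹, by positivity⟩, S.antilipschitz_of_bound fun x => ?_⟩⟩
  · rw [Submodule.topologicalClosure_eq_top_iff, ContinuousLinearMap.orthogonal_range,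
      ← ContinuousLinearMap.star_eq_adjoint, hS.star_eq, Submodule.eq_bot_iff]
    intro x hx
    have hx0 : S x = 0 := hx
    have := h x
    rw [hx0, norm_zero] at this
    have h0 : ‖x‖ ≤ 0 := by nlinarith [norm_nonneg x]
    exact norm_le_zero_iff.1 h0
  · have := h x
    change ‖x‖ ≤ c⁻¹ * ‖S x‖
    rw [inv_mul_eq_div, le_div_iff₀ hc]
    linarith

/-- A symmetric operator with numerical range above `-1`, and below `1 - δ` on the orthogonal
complement of its fixed vectors, has spectrum in `[-1, 1 - δ] ∪ {1}`. -/
theorem spectrum_subset_of_gap (T : E →ₗ[ℂ] E) (hT : T.IsSymmetric) {δ : ℝ}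
    (hlow : ∀ x, -‖x‖ ^ 2 ≤ (⟪T x, x⟫_ℂ).re)
    (hgap : ∀ x, (∀ y, T y = y → ⟪y, x⟫_ℂ = 0) → δ * ‖x‖ ^ 2 ≤ ‖x‖ ^ 2 - (⟪T x, x⟫_ℂ).re) :
    spectrum ℂ (T : Module.End ℂ E) ⊆ Complex.ofReal '' (Set.Icc (-1) (1 - δ) ∪ {1}) := by
  intro z hz
  -- Hellinger–Toeplitz: a symmetric operator defined on the whole Hilbert space is bounded.
  set S : E →L[ℂ] E := (hT.toSelfAdjoint : selfAdjoint (E →L[ℂ] E)).1 with hS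
  have hSsa : IsSelfAdjoint S := hT.toSelfAdjoint.2
  have hSx : ∀ x, S x = T x := fun x => hT.toSelfAdjoint_apply
  have hz' : z ∈ spectrum ℂ S := by
    rw [spectrum.mem_iff] at hz ⊢
    intro hu
    apply hz
    rw [ContinuousLinearMap.isUnit_iff_isUnit_toLinearMap] at hu
    have h : algebraMap ℂ (Module.End ℂ E) z - T
        = ((algebraMap ℂ (E →L[ℂ] E) z - S : E →L[ℂ] E) : E →ₗ[ℂ] E) := by
      ext x
      simp [hSx, Algebra.algebraMap_eq_smul_one]
    exact h ▸ hu
  have hzre : z = z.re := hSsa.mem_spectrum_eq_re hz'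
  set t : ℝ := z.re with ht
  refine ⟨t, ?_, hzre.symm⟩
  by_contra hmem
  simp only [Set.mem_union, Set.mem_Icc, Set.mem_singleton_iff, not_or, not_and_or, not_le] at hmem
  obtain ⟨hmem, ht1⟩ := hmem
  -- By Cauchy–Schwarz, pairing with a vector `w` of the same norm as `x` shows that `T - t` is
  -- bounded below, which contradicts `t` being in the spectrum.
  suffices ∃ c : ℝ, 0 < c ∧ ∀ x, ∃ w, ‖w‖ = ‖x‖ ∧ c * ‖x‖ ^ 2 ≤ (⟪T x - (t : ℂ) • x, w⟫_ℂ).re by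
    obtain ⟨c, hc, H⟩ := this
    rw [spectrum.mem_iff] at hz'
    apply hz'
    refine isUnit_of_isSelfAdjoint_of_bound (c := c) ?_ hc fun x => ?_
    · rw [hzre]
      refine IsSelfAdjoint.sub ?_ hSsa
      exact IsSelfAdjoint.algebraMap _ (Complex.conj_ofReal t)
    · obtain ⟨w, hw, hcw⟩ := H x
      have hval : (algebraMap ℂ (E →L[ℂ] E) z - S) x = -(T x - (t : ℂ) • x) := by
        rw [hzre]
        simp [hSx, Algebra.algebraMap_eq_smul_one]
      rw [hval, norm_neg]
      rcases eq_or_lt_of_le (norm_nonneg x) with h0 | h0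
      · rw [← h0]; simp
      · have h1 := (Complex.re_le_norm _).trans
          (norm_inner_le_norm (𝕜 := ℂ) (T x - (t : ℂ) • x) w)
        rw [hw] at h1
        have h2 := hcw.trans h1
        nlinarith
  rcases hmem with hlt | hgt
  · refine ⟨-1 - t, by linarith, fun x => ⟨x, rfl, ?_⟩⟩
    rw [inner_sub_left, inner_smul_left, Complex.conj_ofReal, Complex.sub_re, Complex.re_ofReal_mul]
    have h1 : (⟪x, x⟫_ℂ).re = ‖x‖ ^ 2 := inner_self_eq_norm_sq (𝕜 := ℂ) x
    rw [h1]
    have := hlow x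
    linarith
  · set K : Submodule ℂ E := (S - 1).ker with hK
    have hKmem : ∀ y, y ∈ K ↔ T y = y := by
      intro y
      simp [hK, LinearMap.mem_ker, hSx, sub_eq_zero]
    have : CompleteSpace K := (S - 1).isClosed_ker.completeSpace_coe
    refine ⟨min |1 - t| (t - (1 - δ)), lt_min (abs_pos.2 (sub_ne_zero.2 (Ne.symm ht1)))
      (by linarith), fun x => ?_⟩
    -- With `x = a + b`, `a` fixed by `T` and `b` orthogonal to the fixed vectors, `T - t` is `1 -
    -- t` on `a` and at most `1 - δ - t < 0` in quadratic form on `b`. Taking `w = s a - b` with `s`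
    -- the sign of `1 - t` makes both contributions positive.
    obtain ⟨s, hs, hs'⟩ : ∃ s : ℝ, |s| = 1 ∧ s * (1 - t) = |1 - t| := by
      rcases abs_choice (1 - t) with h | h
      · exact ⟨1, by simp, by rw [h]; ring⟩
      · exact ⟨-1, by simp, by rw [h]; ring⟩
    obtain ⟨a, ha, b, hb, rfl⟩ := K.exists_add_mem_mem_orthogonal x
    have hab : ⟪a, b⟫_ℂ = 0 := hb a ha
    have hba : ⟪b, a⟫_ℂ = 0 := inner_eq_zero_symm.1 hab
    have hTa : T a = a := (hKmem a).1 ha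
    have hnorm : ‖a + b‖ ^ 2 = ‖a‖ ^ 2 + ‖b‖ ^ 2 := by
      have := norm_add_sq_eq_norm_sq_add_norm_sq_of_inner_eq_zero a b hab
      nlinarith
    refine ⟨(s : ℂ) • a - b, ?_, ?_⟩
    · have h1 : ⟪(s : ℂ) • a, b⟫_ℂ = 0 := by rw [inner_smul_left, hab, mul_zero]
      have h2 := norm_sub_sq (𝕜 := ℂ) ((s : ℂ) • a) b
      rw [h1, norm_smul, Complex.norm_real, Real.norm_eq_abs, hs] at h2
      have h3 : ‖(s : ℂ) • a - b‖ ^ 2 = ‖a + b‖ ^ 2 := by rw [h2, hnorm]; simp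
      exact (sq_eq_sq₀ (norm_nonneg _) (norm_nonneg _)).1 h3
    · have hTb : ⟪T b, a⟫_ℂ = 0 := by rw [hT b a, hTa, hba]
      have haa : ⟪a, a⟫_ℂ = ((‖a‖ ^ 2 : ℝ) : ℂ) := by
        rw [inner_self_eq_norm_sq_to_K]; norm_cast
      have hbb : ⟪b, b⟫_ℂ = ((‖b‖ ^ 2 : ℝ) : ℂ) := by
        rw [inner_self_eq_norm_sq_to_K]; norm_cast
      have hin : ⟪T (a + b) - (t : ℂ) • (a + b), (s : ℂ) • a - b⟫_ℂ
          = ((s * (1 - t) * ‖a‖ ^ 2 + t * ‖b‖ ^ 2 : ℝ) : ℂ) - ⟪T b, b⟫_ℂ := by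
        simp only [map_add, hTa, smul_add, inner_sub_left, inner_sub_right, inner_add_left,
          inner_smul_left, inner_smul_right, Complex.conj_ofReal, hTb, hab, hba, haa, hbb]
        push_cast
        ring
      rw [hin, hs', Complex.sub_re, Complex.ofReal_re, hnorm]
      have hg := hgap b fun y hy => hb y ((hKmem y).2 hy)
      have h1 := mul_le_mul_of_nonneg_right (min_le_left |1 - t| (t - (1 - δ))) (sq_nonneg ‖a‖)
      have h2 := mul_le_mul_of_nonneg_right (min_le_right |1 - t| (t - (1 - δ))) (sq_nonneg ‖b‖)
      nlinarith

end Gap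

/-! ### Sums over orbits weighted by the orders of the stabilizers -/

section Orbit

variable {G V : Type*} [Group G] [MulAction G V]

theorem exists_smul_out_eq (u : V) :
    ∃ γ : G, γ • (Quotient.mk _ u : MulAction.orbitRel.Quotient G V).out = u := by
  have h := Quotient.mk_out (s := MulAction.orbitRel G V) u
  exact MulAction.mem_orbit_iff.1 (MulAction.mem_orbit_symm.1 (MulAction.orbitRel_apply.1 h))

theorem natCard_setOf_smul_eq (x : V) (γ₀ : G) :
    Nat.card {γ : G | γ • x = γ₀ • x} = Nat.card (MulAction.stabilizer G x) := by
  refine Nat.card_congr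
    { toFun := fun γ => ⟨γ₀⁻¹ * γ, ?_⟩
      invFun := fun γ => ⟨γ₀ * γ, ?_⟩
      left_inv := fun γ => by simp
      right_inv := fun γ => by simp }
  · rw [MulAction.mem_stabilizer_iff, mul_smul, show (γ : G) • x = γ₀ • x from γ.2, inv_smul_smul]
  · change (γ₀ * (γ : G)) • x = γ₀ • x
    rw [mul_smul, MulAction.mem_stabilizer_iff.1 γ.2]

theorem finite_setOf_smul_eq (x : V) [Finite (MulAction.stabilizer G x)] (y : V) :
    {γ : G | γ • x = y}.Finite := by
  by_cases h : ∃ γ₀ : G, γ₀ • x = y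
  · obtain ⟨γ₀, rfl⟩ := h
    exact (Nat.finite_of_card_ne_zero
      (by rw [natCard_setOf_smul_eq]; exact Nat.card_pos.ne') : Finite {γ : G | γ • x = γ₀ • x})
  · convert Set.finite_empty
    ext γ
    simpa using fun hγ => h ⟨γ, hγ⟩

variable (X : SimpleGraph V) [X.LocallyFinite]

theorem finite_setOf_adj_smul (u x : V) [Finite (MulAction.stabilizer G x)] :
    {γ : G | X.Adj u (γ • x)}.Finite := by
  have : {γ : G | X.Adj u (γ • x)} = (fun γ : G => γ • x) ⁻¹' (X.neighborFinset u) := by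
    ext γ; simp
  rw [this]
  exact (X.neighborFinset u).finite_toSet.preimage' fun y _ => finite_setOf_smul_eq x y

-- The elements carrying `x` to a given point of its orbit form a coset of the stabilizer, so each
-- neighbour of `u` in that orbit is counted `|G_x|` times.
open Classical in
theorem sum_setOf_adj_smul {R : Type*} [Semiring R] (u x : V)
    [Finite (MulAction.stabilizer G x)] (F : V → R) :
    ∑ γ ∈ (finite_setOf_adj_smul (G := G) X u x).toFinset, F (γ • x)
      = Nat.card (MulAction.stabilizer G x) *
        ∑ v ∈ X.neighborFinset u with v ∈ MulAction.orbit G x, F v := by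
  rw [Finset.sum_comp F (fun γ : G => γ • x), Finset.mul_sum]
  refine Finset.sum_congr ?_ fun v hv => ?_
  · ext v
    simp only [Finset.mem_image, Set.Finite.mem_toFinset, Set.mem_ofPred_eq, Finset.mem_filter,
      SimpleGraph.mem_neighborFinset, MulAction.mem_orbit_iff]
    constructor
    · rintro ⟨γ, h, rfl⟩; exact ⟨h, γ, rfl⟩
    · rintro ⟨h, γ, rfl⟩; exact ⟨γ, h, rfl⟩
  · simp only [Finset.mem_filter, SimpleGraph.mem_neighborFinset, MulAction.mem_orbit_iff] at hv
    obtain ⟨hadj, γ₀, rfl⟩ := hv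
    rw [nsmul_eq_mul, ← natCard_setOf_smul_eq x γ₀]
    congr 2
    rw [← Set.ncard_coe_finset]
    change _ = Set.ncard _
    congr 1
    ext γ
    simp only [Finset.coe_filter, Set.Finite.mem_toFinset, Set.mem_ofPred_eq]
    exact ⟨fun h => h.2, fun h => ⟨h ▸ hadj, h⟩⟩

variable (G) in
/-- The sum of `φ u` over orbit representatives `u`, with weights the inverse orders of the
stabilizers. -/
def orbitSum {R : Type*} [Field R] [Fintype (MulAction.orbitRel.Quotient G V)] (φ : V → R) : R :=
  ∑ o : MulAction.orbitRel.Quotient G V,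
    (Nat.card (MulAction.stabilizer G o.out) : R)⁻¹ * φ o.out

/-- Mass transport: for an invariant function on edges, the outgoing and incoming masses agree. -/
theorem orbitSum_sum_neighbor_swap {R : Type*} [Field R] [CharZero R]
    [Fintype (MulAction.orbitRel.Quotient G V)]
    (hfin : ∀ x : V, Finite (MulAction.stabilizer G x))
    (hadj : ∀ (γ : G) (u v : V), X.Adj (γ • u) (γ • v) ↔ X.Adj u v)
    (φ : V → V → R) (hφ : ∀ (γ : G) (u v : V), φ (γ • u) (γ • v) = φ u v) :
    orbitSum G (fun u => ∑ v ∈ X.neighborFinset u, φ u v)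
      = orbitSum G (fun u => ∑ v ∈ X.neighborFinset u, φ v u) := by
  classical
  let w : MulAction.orbitRel.Quotient G V → R :=
    fun o => (Nat.card (MulAction.stabilizer G o.out) : R)⁻¹
  -- Sorting neighbours by orbit and parametrizing them by group elements costs a factor `w o'`, so
  -- that the weights become symmetric in `o` and `o'`.
  have key : ∀ ψ : V → V → R, orbitSum G (fun u => ∑ v ∈ X.neighborFinset u, ψ u v)
      = ∑ o : MulAction.orbitRel.Quotient G V, ∑ o' : MulAction.orbitRel.Quotient G V, w o * w o' *
        ∑ γ ∈ (finite_setOf_adj_smul (G := G) X o.out o'.out).toFinset, ψ o.out (γ • o'.out) := by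
    intro ψ
    refine Finset.sum_congr rfl fun o _ => ?_
    change w o * _ = _
    simp_rw [mul_assoc]
    rw [← Finset.mul_sum]
    congr 1
    rw [← Finset.sum_fiberwise (X.neighborFinset o.out)
      (fun v => (Quotient.mk _ v : MulAction.orbitRel.Quotient G V))]
    refine Finset.sum_congr rfl fun o' _ => ?_
    rw [sum_setOf_adj_smul X o.out o'.out (ψ o.out), ← mul_assoc, inv_mul_cancel₀, one_mul]
    · refine Finset.sum_congr (Finset.filter_congr fun v _ => ?_) fun _ _ => rfl
      rw [← MulAction.orbitRel_apply, ← Quotient.eq (r := MulAction.orbitRel G V), Quotient.out_eq]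
    · exact_mod_cast Nat.card_pos.ne'
  rw [key, key (fun u v => φ v u), Finset.sum_comm]
  refine Finset.sum_congr rfl fun o _ => Finset.sum_congr rfl fun o' _ => ?_
  rw [mul_comm (w o') (w o)]
  congr 1
  -- Translation by `γ⁻¹` turns an edge from `o` to `γ o'` into one from `γ⁻¹ o` to `o'`; invariance
  -- of `φ` matches the terms.
  refine Finset.sum_nbij' (fun γ => γ⁻¹) (fun γ => γ⁻¹) ?_ ?_ (fun _ _ => inv_inv _)
    (fun _ _ => inv_inv _) ?_
  · intro γ hγ
    simp only [Set.Finite.mem_toFinset, Set.mem_ofPred_eq] at hγ ⊢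
    rw [← hadj γ, smul_inv_smul]
    exact hγ.symm
  · intro γ hγ
    simp only [Set.Finite.mem_toFinset, Set.mem_ofPred_eq] at hγ ⊢
    rw [← hadj γ, smul_inv_smul]
    exact hγ.symm
  · intro γ _
    rw [← hφ γ (γ⁻¹ • _), smul_inv_smul]

end Orbit

section OrbitSum

variable {G V : Type*} [Group G] [MulAction G V] [Fintype (MulAction.orbitRel.Quotient G V)]

theorem orbitSum_add {R : Type*} [Field R] (φ ψ : V → R) :
    orbitSum G (fun u => φ u + ψ u) = orbitSum G φ + orbitSum G ψ := by
  simp [orbitSum, mul_add, Finset.sum_add_distrib]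

theorem orbitSum_const_mul {R : Type*} [Field R] (c : R) (φ : V → R) :
    orbitSum G (fun u => c * φ u) = c * orbitSum G φ := by
  simp [orbitSum, Finset.mul_sum, mul_left_comm]

theorem orbitSum_nonneg {φ : V → ℝ} (h : ∀ u, 0 ≤ φ u) : 0 ≤ orbitSum G φ :=
  Finset.sum_nonneg fun _ _ => mul_nonneg (by positivity) (h _)

theorem orbitSum_re (φ : V → ℂ) : (orbitSum G φ).re = orbitSum G (fun u => (φ u).re) := by
  simp only [orbitSum, Complex.re_sum]
  refine Finset.sum_congr rfl fun o _ => ?_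
  rw [← Complex.ofReal_natCast, ← Complex.ofReal_inv, Complex.re_ofReal_mul]

theorem le_card_mul_orbitSum (hfin : ∀ x : V, Finite (MulAction.stabilizer G x))
    {φ : V → ℝ} (h : ∀ u, 0 ≤ φ u) (o : MulAction.orbitRel.Quotient G V) :
    φ o.out ≤ Nat.card (MulAction.stabilizer G o.out) * orbitSum G φ := by
  have hpos : (0 : ℝ) < Nat.card (MulAction.stabilizer G o.out) := by exact_mod_cast Nat.card_pos
  rw [← inv_mul_le_iff₀ hpos]
  exact Finset.single_le_sum
    (f := fun o : MulAction.orbitRel.Quotient G V =>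
      (Nat.card (MulAction.stabilizer G o.out) : ℝ)⁻¹ * φ o.out)
    (fun o _ => mul_nonneg (by positivity) (h _)) (Finset.mem_univ o)

theorem orbitSum_le_card_mul {φ : V → ℝ} {B : ℝ} (hB : 0 ≤ B)
    (h : ∀ o : MulAction.orbitRel.Quotient G V, φ o.out ≤ B) :
    orbitSum G φ ≤ Fintype.card (MulAction.orbitRel.Quotient G V) * B := by
  rw [← nsmul_eq_mul, ← Finset.card_univ]
  refine Finset.sum_le_card_nsmul _ _ _ fun o _ => ?_
  refine (mul_le_mul_of_nonneg_left (h o) (by positivity)).trans ?_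
  exact mul_le_of_le_one_left hB (Nat.cast_inv_le_one _)

end OrbitSum

/-! ### Almost invariant vectors are close to invariant vectors -/

section AlmostInvariant

variable {G : Type u} [Group G] {H : Type v} [NormedAddCommGroup H] [InnerProductSpace ℂ H]

/-- The subspace of vectors fixed by a unitary representation. -/
def invariants (π : UnitaryRep G H) : Submodule ℂ H where
  carrier := {ξ | ∀ γ, π γ ξ = ξ}
  add_mem' := fun ha hb γ => by rw [map_add, ha γ, hb γ]
  zero_mem' := fun γ => map_zero _
  smul_mem' := fun c ξ hξ γ => by rw [map_smul, hξ γ]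

theorem mem_invariants {π : UnitaryRep G H} {ξ : H} : ξ ∈ invariants π ↔ ∀ γ, π γ ξ = ξ := Iff.rfl

theorem isClosed_invariants (π : UnitaryRep G H) : IsClosed (invariants π : Set H) := by
  have : (invariants π : Set H) = ⋂ γ, {ξ | π γ ξ = ξ} := by
    ext ξ; simp [mem_invariants]
  rw [this]
  exact isClosed_iInter fun γ => isClosed_eq (π γ).continuous continuous_id

theorem inv_apply_self (π : UnitaryRep G H) (γ : G) (ξ : H) : π γ⁻¹ (π γ ξ) = ξ := by
  change (π γ⁻¹ * π γ) ξ = ξ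
  rw [← map_mul, inv_mul_cancel, map_one]
  rfl

theorem apply_mem_orthogonal_invariants (π : UnitaryRep G H) (γ : G) {ξ : H}
    (hξ : ξ ∈ (invariants π)ᗮ) : π γ ξ ∈ (invariants π)ᗮ := by
  intro η hη
  rw [← mem_invariants.1 hη γ, LinearIsometryEquiv.inner_map_map]
  exact hξ η hη

/-- The restriction of a unitary representation to the complement of its fixed vectors. -/
def orthogonalInvariantsRep (π : UnitaryRep G H) : UnitaryRep G (invariants π)ᗮ where
  toFun γ :=
    { toFun := fun ξ => ⟨π γ ξ, apply_mem_orthogonal_invariants π γ ξ.2⟩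
      invFun := fun ξ => ⟨π γ⁻¹ ξ, apply_mem_orthogonal_invariants π γ⁻¹ ξ.2⟩
      left_inv := fun ξ => Subtype.ext (inv_apply_self π γ ξ)
      right_inv := fun ξ => Subtype.ext (by simp)
      map_add' := fun _ _ => Subtype.ext (map_add (π γ) _ _)
      map_smul' := fun _ _ => Subtype.ext (map_smul (π γ) _ _)
      norm_map' := fun ξ => (π γ).norm_map ξ }
  map_one' := by ext ξ; simp
  map_mul' γ γ' := by ext ξ; simp

theorem not_hasInvariantVector_orthogonalInvariantsRep (π : UnitaryRep G H) :
    ¬ HasInvariantVector (orthogonalInvariantsRep π) := by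
  rintro ⟨ξ, hξ0, hξ⟩
  have h1 : (ξ : H) ∈ invariants π := fun γ => congrArg Subtype.val (hξ γ)
  have h2 : ⟪(ξ : H), ξ⟫_ℂ = 0 := ξ.2 _ h1
  exact hξ0 (Subtype.ext (inner_self_eq_zero.1 h2))

/-- The complement of the invariants contains no nonzero invariant vector, so by property (T) it
contains no `(Q, ε)`-invariant vector either. This is applied to the component `ξ - η` there, which
`π x` moves exactly as far as it moves `ξ`. The condition `0 ≤ B` matters when `Q` is empty. -/
theorem HasPropertyT.exists_dist_invariants_le (hG : HasPropertyT G) :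
    ∃ (Q : Finset G) (ε : ℝ), 0 < ε ∧
      ∀ (H : Type u) [NormedAddCommGroup H] [InnerProductSpace ℂ H] [CompleteSpace H]
        (π : UnitaryRep G H) (ξ : H), ∃ η ∈ invariants π, ∀ B : ℝ, 0 ≤ B →
          (∀ x ∈ Q, ‖π x ξ - ξ‖ ≤ B) → ε * ‖ξ - η‖ ≤ B := by
  obtain ⟨Q, ε, hε, hQ⟩ := hG
  refine ⟨Q, ε, hε, fun H _ _ _ π ξ => ?_⟩
  have : CompleteSpace (invariants π) := (isClosed_invariants π).completeSpace_coe
  obtain ⟨η, hη, ζ, hζ, rfl⟩ := (invariants π).exists_add_mem_mem_orthogonal ξ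
  refine ⟨η, hη, fun B hB0 hB => ?_⟩
  rw [add_sub_cancel_left]
  by_contra! hlt
  refine not_hasInvariantVector_orthogonalInvariantsRep π
    (hQ _ (orthogonalInvariantsRep π) ⟨⟨ζ, hζ⟩, ?_, fun x hx => ?_⟩)
  · intro h
    obtain rfl : ζ = 0 := congrArg Subtype.val h
    rw [norm_zero, mul_zero] at hlt
    linarith
  · refine lt_of_le_of_lt ?_ hlt
    have h := hB x hx
    rw [map_add, mem_invariants.1 hη x, add_sub_add_left_eq_sub] at h
    exact h

end AlmostInvariant

/-! ### The Poincaré inequality for equivariant functions -/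

section Poincare

theorem norm_sub_le_length_mul {V H : Type*} [SeminormedAddCommGroup H] {X : SimpleGraph V}
    {f : V → H} {η : ℝ}
    (h : ∀ u v, X.Adj u v → ‖f u - f v‖ ≤ η) {u v : V} (p : X.Walk u v) :
    ‖f u - f v‖ ≤ p.length * η := by
  induction p with
  | nil => simp
  | @cons a b c hab p ih =>
    rw [SimpleGraph.Walk.length_cons, ← sub_add_sub_cancel (f a) (f b) (f c)]
    refine (norm_add_le _ _).trans ?_
    push_cast
    linarith [h a b hab]

variable {V : Type u} {X : SimpleGraph V} {Γ : Subgroup (X ≃g X)}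
  {H : Type v} [NormedAddCommGroup H] [InnerProductSpace ℂ H] {π : UnitaryRep Γ H}
  [Fintype (MulAction.orbitRel.Quotient Γ V)]

/-- Translated so as to start at an orbit representative, the edge contributes a single term of the
Dirichlet sum. Multiplying by the stabilizer order undoes the weight; the sum of all these orders
bounds it uniformly. -/
theorem norm_sub_sq_le_of_adj [X.LocallyFinite] (hfin : ∀ x : V, Finite (MulAction.stabilizer Γ x))
    {f : V → H} (hf : f ∈ equivariantFunctions Γ π) {u v : V} (huv : X.Adj u v) :
    ‖f u - f v‖ ^ 2 ≤ (∑ o : MulAction.orbitRel.Quotient Γ V,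
        (Nat.card (MulAction.stabilizer Γ o.out) : ℝ)) *
      orbitSum Γ (fun u => ∑ v ∈ X.neighborFinset u, ‖f u - f v‖ ^ 2) := by
  have hnn : ∀ u, 0 ≤ ∑ v ∈ X.neighborFinset u, ‖f u - f v‖ ^ 2 :=
    fun u => Finset.sum_nonneg fun _ _ => by positivity
  let o : MulAction.orbitRel.Quotient Γ V := Quotient.mk _ u
  obtain ⟨γ, hγ⟩ : ∃ γ : Γ, γ • o.out = u := exists_smul_out_eq u
  have hv : v = γ • (γ⁻¹ • v) := (smul_inv_smul γ v).symm
  have hadj : X.Adj o.out (γ⁻¹ • v) := by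
    apply (γ : X ≃g X).map_adj_iff.1
    change X.Adj (γ • o.out) (γ • (γ⁻¹ • v))
    rwa [hγ, smul_inv_smul]
  have hnorm : ‖f u - f v‖ = ‖f o.out - f (γ⁻¹ • v)‖ := by
    conv_lhs => rw [hv, ← hγ, hf γ, hf γ, ← map_sub, LinearIsometryEquiv.norm_map]
  rw [hnorm]
  calc ‖f o.out - f (γ⁻¹ • v)‖ ^ 2
      ≤ ∑ v ∈ X.neighborFinset o.out, ‖f o.out - f v‖ ^ 2 :=
        Finset.single_le_sum (f := fun v => ‖f o.out - f v‖ ^ 2) (fun _ _ => by positivity)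
          ((X.mem_neighborFinset _ _).2 hadj)
    _ ≤ Nat.card (MulAction.stabilizer Γ o.out) *
          orbitSum Γ (fun u => ∑ v ∈ X.neighborFinset u, ‖f u - f v‖ ^ 2) :=
        le_card_mul_orbitSum hfin hnn o
    _ ≤ _ := by
        refine mul_le_mul_of_nonneg_right ?_ (orbitSum_nonneg hnn)
        exact Finset.single_le_sum
          (f := fun o : MulAction.orbitRel.Quotient Γ V =>
            (Nat.card (MulAction.stabilizer Γ o.out) : ℝ))
          (fun _ _ => Nat.cast_nonneg _) (Finset.mem_univ o)

/-- Pythagoras: `f` is orthogonal to the constant function `η`. -/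
theorem orbitSum_norm_sq_le_of_orthogonal {f : V → H} {η : H}
    (h : orbitSum Γ (fun u => ⟪η, f u⟫_ℂ) = 0) :
    orbitSum Γ (fun u => ‖f u‖ ^ 2) ≤ orbitSum Γ (fun u => ‖f u - η‖ ^ 2) := by
  have h1 : ∀ u, ‖f u - η‖ ^ 2 = ‖f u‖ ^ 2 + (-2 * (⟪η, f u⟫_ℂ).re + ‖η‖ ^ 2) := by
    intro u
    rw [norm_sub_sq (𝕜 := ℂ), inner_re_symm]
    change _ - 2 * (⟪η, f u⟫_ℂ).re + _ = _
    ring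
  simp_rw [h1]
  rw [orbitSum_add, orbitSum_add, orbitSum_const_mul, ← orbitSum_re, h]
  have : 0 ≤ orbitSum Γ (fun _ : V => ‖η‖ ^ 2) := orbitSum_nonneg fun _ => by positivity
  simpa using this

variable (Γ) in
theorem exists_poincare [X.LocallyFinite] (hX : X.Connected) (hfin : ∀ x : V, Finite (MulAction.stabilizer Γ x))
    (hT : HasPropertyT Γ) :
    ∃ N : ℝ, 0 < N ∧
      ∀ (H : Type u) [NormedAddCommGroup H] [InnerProductSpace ℂ H] [CompleteSpace H]
        (π : UnitaryRep Γ H), ∀ f ∈ equivariantFunctions Γ π,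
          (∀ η ∈ invariants π, orbitSum Γ (fun u => ⟪η, f u⟫_ℂ) = 0) →
          orbitSum Γ (fun u => ‖f u‖ ^ 2) ≤
            N * orbitSum Γ (fun u => ∑ v ∈ X.neighborFinset u, ‖f u - f v‖ ^ 2) := by
  obtain ⟨Q, ε, hε, hQ⟩ := hT.exists_dist_invariants_le
  obtain ⟨u₀⟩ := hX.nonempty
  set C : ℝ := ∑ o : MulAction.orbitRel.Quotient Γ V,
    (Nat.card (MulAction.stabilizer Γ o.out) : ℝ) with hC
  have hC0 : 0 ≤ C := Finset.sum_nonneg fun _ _ => Nat.cast_nonneg _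
  -- `D` bounds the distance from `u₀` to its translates by `Q` and to all orbit representatives.
  set D : ℝ := ∑ x ∈ Q, (X.dist (x • u₀) u₀ : ℝ) +
    ∑ o : MulAction.orbitRel.Quotient Γ V, (X.dist o.out u₀ : ℝ) with hD
  have hQ0 : 0 ≤ ∑ x ∈ Q, (X.dist (x • u₀) u₀ : ℝ) :=
    Finset.sum_nonneg fun _ _ => Nat.cast_nonneg _
  have hO0 : 0 ≤ ∑ o : MulAction.orbitRel.Quotient Γ V, (X.dist o.out u₀ : ℝ) :=
    Finset.sum_nonneg fun _ _ => Nat.cast_nonneg _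
  have hD0 : 0 ≤ D := add_nonneg hQ0 hO0
  have hDQ : ∀ x ∈ Q, (X.dist (x • u₀) u₀ : ℝ) ≤ D := fun x hx =>
    (Finset.single_le_sum (f := fun x : Γ => (X.dist (x • u₀) u₀ : ℝ))
      (fun _ _ => Nat.cast_nonneg _) hx).trans (le_add_of_nonneg_right hO0)
  have hDo : ∀ o : MulAction.orbitRel.Quotient Γ V, (X.dist o.out u₀ : ℝ) ≤ D := fun o =>
    (Finset.single_le_sum
      (f := fun o : MulAction.orbitRel.Quotient Γ V => (X.dist o.out u₀ : ℝ))
      (fun _ _ => Nat.cast_nonneg _) (Finset.mem_univ o)).trans (le_add_of_nonneg_left hQ0)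
  -- `D` pays for going from `f o.out` to `f u₀`, and `D / ε` for going from `f u₀` to `η`. The `+
  -- 1` only ensures positivity.
  refine ⟨Fintype.card (MulAction.orbitRel.Quotient Γ V) * ((D + D / ε) ^ 2 * C) + 1,
    by positivity, fun H _ _ _ π f hf horth => ?_⟩
  set A : ℝ := orbitSum Γ (fun u => ∑ v ∈ X.neighborFinset u, ‖f u - f v‖ ^ 2) with hA
  have hA0 : 0 ≤ A := orbitSum_nonneg fun u => Finset.sum_nonneg fun _ _ => by positivity
  have hedge : ∀ u v, X.Adj u v → ‖f u - f v‖ ≤ √(C * A) := fun u v huv =>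
    Real.le_sqrt_of_sq_le (norm_sub_sq_le_of_adj hfin hf huv)
  have hdist : ∀ u v, ‖f u - f v‖ ≤ X.dist u v * √(C * A) := fun u v => by
    obtain ⟨p, hp⟩ := hX.exists_walk_length_eq_dist u v
    rw [← hp]
    exact norm_sub_le_length_mul hedge p
  obtain ⟨η, hη, hηB⟩ := hQ H π (f u₀)
  -- By equivariance `π x (f u₀) - f u₀` is the difference of `f` at `x • u₀` and `u₀`, hence is
  -- controlled by a path between them.
  have hclose : ε * ‖f u₀ - η‖ ≤ D * √(C * A) := by
    refine hηB _ (by positivity) fun x hx => ?_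
    rw [← hf x u₀]
    exact (hdist _ _).trans (mul_le_mul_of_nonneg_right (hDQ x hx) (Real.sqrt_nonneg _))
  have hrep : ∀ o : MulAction.orbitRel.Quotient Γ V,
      ‖f o.out - η‖ ^ 2 ≤ (D + D / ε) ^ 2 * (C * A) := fun o => by
    have h1 : ‖f u₀ - η‖ ≤ D / ε * √(C * A) := by
      rw [div_mul_eq_mul_div, le_div_iff₀ hε]
      linarith
    have h2 : ‖f o.out - f u₀‖ ≤ D * √(C * A) :=
      (hdist _ _).trans (mul_le_mul_of_nonneg_right (hDo o) (Real.sqrt_nonneg _))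
    have h3 : ‖f o.out - η‖ ≤ (D + D / ε) * √(C * A) := by
      rw [← sub_add_sub_cancel _ (f u₀) η, add_mul]
      exact (norm_add_le _ _).trans (add_le_add h2 h1)
    calc ‖f o.out - η‖ ^ 2 ≤ ((D + D / ε) * √(C * A)) ^ 2 :=
          pow_le_pow_left₀ (norm_nonneg _) h3 2
      _ = _ := by rw [mul_pow, Real.sq_sqrt (by positivity)]
  calc orbitSum Γ (fun u => ‖f u‖ ^ 2) ≤ orbitSum Γ (fun u => ‖f u - η‖ ^ 2) :=
        orbitSum_norm_sq_le_of_orthogonal (horth η hη)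
    _ ≤ Fintype.card (MulAction.orbitRel.Quotient Γ V) * ((D + D / ε) ^ 2 * (C * A)) :=
        orbitSum_le_card_mul (by positivity) hrep
    _ ≤ _ := by nlinarith

end Poincare

/-! ### The Hilbert space of equivariant functions -/

section Embedding

variable {V : Type u} {X : SimpleGraph V} {Γ : Subgroup (X ≃g X)}
  {H : Type v} [NormedAddCommGroup H] [InnerProductSpace ℂ H]

variable (Γ) in
/-- The square root of the weight of an orbit. -/
def orbitWeight (o : MulAction.orbitRel.Quotient Γ V) : ℂ :=
  ((√((Nat.card (MulAction.stabilizer Γ o.out) : ℝ)⁻¹) : ℝ) : ℂ)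

theorem orbitWeight_ne_zero (hfin : ∀ x : V, Finite (MulAction.stabilizer Γ x))
    (o : MulAction.orbitRel.Quotient Γ V) : orbitWeight Γ o ≠ 0 := by
  have hpos : (0 : ℝ) < Nat.card (MulAction.stabilizer Γ o.out) := by exact_mod_cast Nat.card_pos
  exact Complex.ofReal_ne_zero.2 (Real.sqrt_pos.2 (inv_pos.2 hpos)).ne'

/-- Equivariant functions are embedded in a Hilbert space by their values, suitably weighted, on
orbit representatives. -/
def orbitEmbedding (π : UnitaryRep Γ H) :
    equivariantFunctions Γ π →ₗ[ℂ] PiLp 2 (fun _ : MulAction.orbitRel.Quotient Γ V => H) where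
  toFun f := WithLp.toLp 2 fun o => orbitWeight Γ o • (f : V → H) o.out
  map_add' f g := by ext o; simp
  map_smul' c f := by ext o; simp [smul_comm c]

theorem orbitEmbedding_apply (π : UnitaryRep Γ H) (f : equivariantFunctions Γ π)
    (o : MulAction.orbitRel.Quotient Γ V) :
    orbitEmbedding π f o = orbitWeight Γ o • (f : V → H) o.out := rfl

theorem orbitEmbedding_injective (hfin : ∀ x : V, Finite (MulAction.stabilizer Γ x))
    (π : UnitaryRep Γ H) : Function.Injective (orbitEmbedding π) := by
  rw [← LinearMap.ker_eq_bot, LinearMap.ker_eq_bot']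
  intro f hf
  ext u
  obtain ⟨γ, hγ⟩ := exists_smul_out_eq (G := Γ) u
  have h : orbitEmbedding π f (Quotient.mk _ u) = 0 := by rw [hf]; rfl
  rw [orbitEmbedding_apply, smul_eq_zero_iff_right (orbitWeight_ne_zero hfin _)] at h
  rw [← hγ, f.2 γ, h, map_zero]
  rfl

/-- The only constraint on the value at a representative is invariance under its stabilizer; such
values extend by `f (s • o.out) = π s (f o.out)`. These conditions are closed, which makes `E_π`
complete. -/
theorem range_orbitEmbedding (hfin : ∀ x : V, Finite (MulAction.stabilizer Γ x))
    (π : UnitaryRep Γ H) :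
    ((LinearMap.range (orbitEmbedding π) : Submodule ℂ _) : Set (PiLp 2 _)) =
      {g | ∀ (o : MulAction.orbitRel.Quotient Γ V) (γ : Γ), γ • o.out = o.out →
        π γ (g o) = g o} := by
  ext g
  constructor
  · rintro ⟨f, rfl⟩ o γ hγ
    rw [orbitEmbedding_apply, map_smul, ← f.2 γ, hγ]
  · intro hg
    choose s hs using exists_smul_out_eq (G := Γ) (V := V)
    let q : V → MulAction.orbitRel.Quotient Γ V := fun u => Quotient.mk _ u
    have hqs : ∀ (γ : Γ) u, q (γ • u) = q u := fun γ u =>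
      Quotient.sound (MulAction.orbitRel_apply.2 (MulAction.mem_orbit u γ))
    have hval : ∀ (γ γ' : Γ) (o : MulAction.orbitRel.Quotient Γ V),
        γ • o.out = γ' • o.out → π γ (g o) = π γ' (g o) := fun γ γ' o h => by
      have h1 := hg o (γ'⁻¹ * γ) (by rw [mul_smul, h, inv_smul_smul])
      calc π γ (g o) = π (γ' * (γ'⁻¹ * γ)) (g o) := by rw [mul_inv_cancel_left]
        _ = π γ' (π (γ'⁻¹ * γ) (g o)) := by rw [map_mul]; rfl
        _ = _ := by rw [h1]
    let f : V → H := fun u => (orbitWeight Γ (q u))⁻¹ • π (s u) (g (q u))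
    have hf : f ∈ equivariantFunctions Γ π := fun γ u => by
      change (orbitWeight Γ (q (γ • u)))⁻¹ • π (s (γ • u)) (g (q (γ • u)))
        = π γ ((orbitWeight Γ (q u))⁻¹ • π (s u) (g (q u)))
      rw [map_smul, hval (s (γ • u)) (γ * s u)]
      · rw [hqs, map_mul]; rfl
      · rw [hs (γ • u), mul_smul, hqs, hs u]
    refine ⟨⟨f, hf⟩, ?_⟩
    ext o
    rw [orbitEmbedding_apply]
    have hqo : q o.out = o := Quotient.out_eq o
    change orbitWeight Γ o • (orbitWeight Γ (q o.out))⁻¹ • π (s o.out) (g (q o.out)) = g o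
    have hso : s o.out • o.out = o.out := by
      conv_lhs => rw [← hqo]
      conv_lhs => rw [hqo]
      have := hs o.out
      change s o.out • (q o.out).out = o.out at this
      rwa [hqo] at this
    rw [hqo, smul_inv_smul₀ (orbitWeight_ne_zero hfin o), hg o _ hso]

theorem isClosed_range_orbitEmbedding (hfin : ∀ x : V, Finite (MulAction.stabilizer Γ x))
    (π : UnitaryRep Γ H) :
    IsClosed ((LinearMap.range (orbitEmbedding π) : Submodule ℂ _) :
      Set (PiLp 2 fun _ : MulAction.orbitRel.Quotient Γ V => H)) := by
  rw [range_orbitEmbedding hfin]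
  simp only [Set.ofPred_forall]
  refine isClosed_iInter fun o => isClosed_iInter fun γ => isClosed_iInter fun _ => ?_
  exact isClosed_eq ((π γ).continuous.comp (PiLp.continuous_apply 2 _ o))
    (PiLp.continuous_apply 2 _ o)

variable [Fintype (MulAction.orbitRel.Quotient Γ V)]

theorem inner_orbitEmbedding (π : UnitaryRep Γ H) (f g : equivariantFunctions Γ π) :
    ⟪orbitEmbedding π f, orbitEmbedding π g⟫_ℂ
      = orbitSum Γ (fun u => ⟪(f : V → H) u, (g : V → H) u⟫_ℂ) := by
  rw [PiLp.inner_apply]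
  refine Finset.sum_congr rfl fun o _ => ?_
  rw [orbitEmbedding_apply, orbitEmbedding_apply, inner_smul_left, inner_smul_right, ← mul_assoc]
  congr 1
  rw [orbitWeight, Complex.conj_ofReal, ← Complex.ofReal_mul,
    Real.mul_self_sqrt (by positivity)]
  simp

theorem norm_orbitEmbedding_sq (π : UnitaryRep Γ H) (f : equivariantFunctions Γ π) :
    ‖orbitEmbedding π f‖ ^ 2 = orbitSum Γ (fun u => ‖(f : V → H) u‖ ^ 2) := by
  rw [← inner_self_eq_norm_sq (𝕜 := ℂ), inner_orbitEmbedding]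
  change Complex.re _ = _
  rw [orbitSum_re]
  congr 1
  funext u
  exact inner_self_eq_norm_sq (𝕜 := ℂ) _

end Embedding

/-! ### The spectral gap of the Markov operators -/

section Markov

variable {V : Type u} {X : SimpleGraph V} {Γ : Subgroup (X ≃g X)}
  {H : Type v} [NormedAddCommGroup H] [InnerProductSpace ℂ H]

theorem markovOperator_apply [X.LocallyFinite] (k : ℕ) (π : UnitaryRep Γ H) (f : equivariantFunctions Γ π) (u : V) :
    (markovOperator k Γ π f : V → H) u
      = (1 / (k : ℂ)) • ∑ v ∈ X.neighborFinset u, (f : V → H) v := rfl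

theorem adj_smul_smul_iff (γ : Γ) (u v : V) : X.Adj (γ • u) (γ • v) ↔ X.Adj u v :=
  (γ : X ≃g X).map_adj_iff

variable [X.LocallyFinite] [Fintype (MulAction.orbitRel.Quotient Γ V)]

theorem orbitSum_inner_markovOperator_left (k : ℕ) (π : UnitaryRep Γ H)
    (f g : equivariantFunctions Γ π) :
    orbitSum Γ (fun u => ⟪(markovOperator k Γ π f : V → H) u, (g : V → H) u⟫_ℂ) =
      (1 / (k : ℂ)) * orbitSum Γ (fun u =>
        ∑ v ∈ X.neighborFinset u, ⟪(f : V → H) v, (g : V → H) u⟫_ℂ) := by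
  rw [← orbitSum_const_mul]
  congr 1
  funext u
  rw [markovOperator_apply, inner_smul_left, sum_inner]
  simp

theorem orbitSum_inner_markovOperator_right (k : ℕ) (π : UnitaryRep Γ H)
    (f g : equivariantFunctions Γ π) :
    orbitSum Γ (fun u => ⟪(f : V → H) u, (markovOperator k Γ π g : V → H) u⟫_ℂ) =
      (1 / (k : ℂ)) * orbitSum Γ (fun u =>
        ∑ v ∈ X.neighborFinset u, ⟪(f : V → H) u, (g : V → H) v⟫_ℂ) := by
  rw [← orbitSum_const_mul]
  congr 1
  funext u
  rw [markovOperator_apply, inner_smul_right, inner_sum]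

/-- As `π` is unitary, `⟪f v, g u⟫` is a `Γ`-invariant function of the pair, so mass transport
applies. -/
theorem orbitSum_inner_markovOperator (hfin : ∀ x : V, Finite (MulAction.stabilizer Γ x)) (k : ℕ)
    (π : UnitaryRep Γ H) (f g : equivariantFunctions Γ π) :
    orbitSum Γ (fun u => ⟪(markovOperator k Γ π f : V → H) u, (g : V → H) u⟫_ℂ) =
      orbitSum Γ (fun u => ⟪(f : V → H) u, (markovOperator k Γ π g : V → H) u⟫_ℂ) := by
  rw [orbitSum_inner_markovOperator_left, orbitSum_inner_markovOperator_right]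
  congr 1
  refine orbitSum_sum_neighbor_swap X hfin adj_smul_smul_iff
    (fun u v => ⟪(f : V → H) v, (g : V → H) u⟫_ℂ) fun γ u v => ?_
  rw [f.2 γ, g.2 γ, LinearIsometryEquiv.inner_map_map]

/-- The Dirichlet form of the Markov operator `M` for `s = 1`, and that of `-M` for `s = -1`. -/
theorem orbitSum_sum_norm_sub_sq (hfin : ∀ x : V, Finite (MulAction.stabilizer Γ x)) {k : ℕ}
    (hk : k ≠ 0) (hreg : X.IsRegularOfDegree k) (π : UnitaryRep Γ H)
    (f : equivariantFunctions Γ π) {s : ℝ} (hs : s ^ 2 = 1) :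
    orbitSum Γ (fun u =>
        ∑ v ∈ X.neighborFinset u, ‖(f : V → H) u - (s : ℂ) • (f : V → H) v‖ ^ 2) =
      2 * k * (orbitSum Γ (fun u => ‖(f : V → H) u‖ ^ 2) - s *
        (orbitSum Γ (fun u => ⟪(markovOperator k Γ π f : V → H) u, (f : V → H) u⟫_ℂ)).re) := by
  have hexp : ∀ u v, ‖(f : V → H) u - (s : ℂ) • (f : V → H) v‖ ^ 2 =
      ‖(f : V → H) u‖ ^ 2 + (‖(f : V → H) v‖ ^ 2 +
        -2 * s * (⟪(f : V → H) v, (f : V → H) u⟫_ℂ).re) := by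
    intro u v
    rw [norm_sub_sq (𝕜 := ℂ), inner_smul_right, norm_smul, mul_pow, Complex.norm_real,
      Real.norm_eq_abs, sq_abs, hs]
    change _ - 2 * ((s : ℂ) * ⟪(f : V → H) u, (f : V → H) v⟫_ℂ).re + _ = _
    have h := inner_re_symm (𝕜 := ℂ) ((f : V → H) u) ((f : V → H) v)
    change (⟪(f : V → H) u, (f : V → H) v⟫_ℂ).re = (⟪(f : V → H) v, (f : V → H) u⟫_ℂ).re at h
    rw [Complex.re_ofReal_mul, h]
    ring
  have hout : orbitSum Γ (fun u => ∑ _v ∈ X.neighborFinset u, ‖(f : V → H) u‖ ^ 2)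
      = k * orbitSum Γ (fun u => ‖(f : V → H) u‖ ^ 2) := by
    rw [← orbitSum_const_mul]
    congr 1
    funext u
    rw [Finset.sum_const, X.card_neighborFinset_eq_degree, hreg u, nsmul_eq_mul]
  have hin : orbitSum Γ (fun u => ∑ v ∈ X.neighborFinset u, ‖(f : V → H) v‖ ^ 2)
      = k * orbitSum Γ (fun u => ‖(f : V → H) u‖ ^ 2) := by
    rw [← hout]
    refine orbitSum_sum_neighbor_swap X hfin adj_smul_smul_iff
      (fun _ v => ‖(f : V → H) v‖ ^ 2) fun γ u v => ?_
    rw [f.2 γ, LinearIsometryEquiv.norm_map]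
  have hcross : orbitSum Γ (fun u => ∑ v ∈ X.neighborFinset u,
        (⟪(f : V → H) v, (f : V → H) u⟫_ℂ).re) = k *
      (orbitSum Γ (fun u => ⟪(markovOperator k Γ π f : V → H) u, (f : V → H) u⟫_ℂ)).re := by
    have hk' : (k : ℝ) ≠ 0 := Nat.cast_ne_zero.2 hk
    rw [orbitSum_inner_markovOperator_left,
      show (1 / (k : ℂ)) = ((1 / (k : ℝ) : ℝ) : ℂ) by push_cast; rfl, Complex.re_ofReal_mul,
      ← mul_assoc, mul_one_div_cancel hk', one_mul, orbitSum_re]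
    simp only [Complex.re_sum]
  simp_rw [hexp, Finset.sum_add_distrib, ← Finset.mul_sum]
  rw [orbitSum_add, orbitSum_add, orbitSum_const_mul, hout, hin, hcross]
  ring

/-- The Poincaré inequality bounds the spectrum of the Markov operator. -/
theorem spectrum_markovOperator_subset [CompleteSpace H]
    (hfin : ∀ x : V, Finite (MulAction.stabilizer Γ x))
    {k : ℕ} (hk : k ≠ 0) (hreg : X.IsRegularOfDegree k) (π : UnitaryRep Γ H) {N : ℝ} (hN : 0 < N)
    (hP : ∀ f ∈ equivariantFunctions Γ π,
      (∀ η ∈ invariants π, orbitSum Γ (fun u => ⟪η, f u⟫_ℂ) = 0) →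
      orbitSum Γ (fun u => ‖f u‖ ^ 2) ≤
        N * orbitSum Γ (fun u => ∑ v ∈ X.neighborFinset u, ‖f u - f v‖ ^ 2)) :
    spectrum ℂ (markovOperator k Γ π) ⊆
      Complex.ofReal '' (Set.Icc (-1) (1 - (N * (2 * k))⁻¹) ∪ {1}) := by
  have hkpos : (0 : ℝ) < k := by exact_mod_cast Nat.pos_of_ne_zero hk
  let e := LinearEquiv.ofInjective (orbitEmbedding π) (orbitEmbedding_injective hfin π)
  have : CompleteSpace (LinearMap.range (orbitEmbedding π)) :=
    (isClosed_range_orbitEmbedding hfin π).completeSpace_coe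
  -- The spectrum is purely algebraic, so it can be computed on the image of `E_π` in the Hilbert
  -- space.
  have hspec : spectrum ℂ (e.conjAlgEquiv ℂ (markovOperator k Γ π))
      = spectrum ℂ (markovOperator k Γ π) :=
    AlgEquiv.spectrum_eq (e.conjAlgEquiv ℂ) (markovOperator k Γ π)
  rw [← hspec]
  set T := e.conjAlgEquiv ℂ (markovOperator k Γ π) with hTdef
  have hT : ∀ f, T (e f) = e (markovOperator k Γ π f) := fun f => by
    rw [hTdef, LinearEquiv.conjAlgEquiv_apply]
    simp
  have hinner : ∀ f g, ⟪e f, e g⟫_ℂ = orbitSum Γ (fun u => ⟪(f : V → H) u, (g : V → H) u⟫_ℂ) :=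
    inner_orbitEmbedding π
  have hnorm : ∀ f, ‖e f‖ ^ 2 = orbitSum Γ (fun u => ‖(f : V → H) u‖ ^ 2) :=
    norm_orbitEmbedding_sq π
  refine spectrum_subset_of_gap T ?_ ?_ ?_
  · intro x y
    obtain ⟨f, rfl⟩ := e.surjective x
    obtain ⟨g, rfl⟩ := e.surjective y
    rw [hT, hT, hinner, hinner, orbitSum_inner_markovOperator hfin]
  · intro x
    obtain ⟨f, rfl⟩ := e.surjective x
    rw [hT, hinner, hnorm]
    have h := orbitSum_sum_norm_sub_sq hfin hk hreg π f (s := -1) (by norm_num)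
    have h0 : 0 ≤ orbitSum Γ (fun u => ∑ v ∈ X.neighborFinset u,
        ‖(f : V → H) u - ((-1 : ℝ) : ℂ) • (f : V → H) v‖ ^ 2) :=
      orbitSum_nonneg fun u => Finset.sum_nonneg fun _ _ => by positivity
    rw [h] at h0
    have := nonneg_of_mul_nonneg_right h0 (by positivity)
    linarith
  · intro x
    obtain ⟨f, rfl⟩ := e.surjective x
    intro hx
    rw [hT, hinner, hnorm]
    have h := orbitSum_sum_norm_sub_sq hfin hk hreg π f (s := 1) (by norm_num)
    simp only [Complex.ofReal_one, one_smul, one_mul] at h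
    have hPf := hP f f.2 fun η hη => by
      -- An invariant vector is a constant equivariant function, fixed by `M_π`; orthogonality to
      -- all fixed vectors thus includes the hypothesis of `hP`.
      let g : equivariantFunctions Γ π := ⟨fun _ => η, fun γ _ => (hη γ).symm⟩
      have hg : markovOperator k Γ π g = g := by
        ext u
        rw [markovOperator_apply, Finset.sum_const, X.card_neighborFinset_eq_degree, hreg u,
          ← Nat.cast_smul_eq_nsmul ℂ, smul_smul, one_div_mul_cancel (Nat.cast_ne_zero.2 hk),
          one_smul]
      have := hx (e g) (by rw [hT, hg])
      rwa [hinner] at this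
    rw [h] at hPf
    rw [inv_mul_le_iff₀ (by positivity)]
    linarith

variable (X) in
theorem exists_isKazhdanConstant {k : ℕ} {Γ : Subgroup (X ≃g X)} (hX : X.Connected)
    (hreg : X.IsRegularOfDegree k) (hΓ : IsKazhdanGraphStructure X Γ) :
    ∃ σ : ℝ, IsKazhdanConstant X k Γ σ := by
  rcases eq_or_ne k 0 with rfl | hk
  -- For `k = 0` the operator is zero and its spectrum is contained in `{0}`.
  · refine ⟨0, one_pos, fun H _ _ _ π => ?_⟩
    have h0 : markovOperator 0 Γ π = 0 := by
      ext f u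
      simp [markovOperator_apply]
    rw [h0]
    intro z hz
    refine ⟨0, Or.inl (by norm_num), ?_⟩
    by_contra hne
    rw [spectrum.mem_iff] at hz
    have h := (IsUnit.mk0 z (Ne.symm hne)).map
      (algebraMap ℂ (Module.End ℂ (equivariantFunctions Γ π)))
    rw [← sub_zero (algebraMap ℂ (Module.End ℂ (equivariantFunctions Γ π)) z)] at h
    exact hz h
  · have := hΓ.finite_orbits
    have := Fintype.ofFinite (MulAction.orbitRel.Quotient Γ V)
    obtain ⟨N, hN, hP⟩ := exists_poincare Γ hX hΓ.finite_stabilizer hΓ.propertyT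
    have hkpos : (0 : ℝ) < k := by exact_mod_cast Nat.pos_of_ne_zero hk
    refine ⟨1 - (N * (2 * k))⁻¹, sub_lt_self _ (by positivity), fun H _ _ _ π => ?_⟩
    exact spectrum_markovOperator_subset hΓ.finite_stabilizer hk hreg π hN (hP H π)

end Markov

/-! ### Lifting eigenfunctions along coverings -/

section Lift

variable {V : Type u} {X : SimpleGraph V} {W : Type v} {Y : SimpleGraph W} {p : V → W}

/-- The image of `p` is closed under passing to neighbours. -/
theorem IsGraphCovering.surjective (hp : IsGraphCovering X Y p) [Nonempty V] (hY : Y.Connected) :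
    Function.Surjective p := by
  intro y
  have key : ∀ {a b : W} (_ : Y.Walk a b), (∃ u, p u = a) → ∃ u, p u = b := by
    intro a b q
    induction q with
    | nil => exact id
    | cons h _ ih =>
      rintro ⟨u, rfl⟩
      obtain ⟨v, -, hv⟩ := (hp.bijOn u).surjOn h
      exact ih ⟨v, hv⟩
  obtain ⟨q⟩ := hY.preconnected (p (Classical.arbitrary V)) y
  exact key q ⟨_, rfl⟩

theorem IsGraphCovering.sum_neighborFinset [X.LocallyFinite] [Y.LocallyFinite]
    (hp : IsGraphCovering X Y p) {R : Type*} [AddCommMonoid R] (φ : W → R) (u : V) :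
    ∑ v ∈ X.neighborFinset u, φ (p v) = ∑ w ∈ Y.neighborFinset (p u), φ w := by
  refine Finset.sum_nbij p ?_ ?_ ?_ fun _ _ => rfl
  · intro v hv
    rw [SimpleGraph.mem_neighborFinset] at hv ⊢
    exact hp.adj u v hv
  · simpa using (hp.bijOn u).injOn
  · simpa using (hp.bijOn u).surjOn

/-- The permutation representation of `G` on `ℓ²(G ⧸ D)`. -/
def quasiRegularRep {G : Type u} [Group G] (D : Subgroup G) [Fintype (G ⧸ D)] :
    UnitaryRep G (EuclideanSpace ℂ (G ⧸ D)) where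
  toFun γ := LinearIsometryEquiv.piLpCongrLeft 2 ℂ ℂ (MulAction.toPerm γ)
  map_one' := by
    ext f q
    simp [LinearIsometryEquiv.piLpCongrLeft_apply, Equiv.piCongrLeft'_apply]
  map_mul' γ γ' := by
    ext f q
    simp [LinearIsometryEquiv.piLpCongrLeft_apply, Equiv.piCongrLeft'_apply, mul_smul]

theorem quasiRegularRep_apply {G : Type u} [Group G] (D : Subgroup G) [Fintype (G ⧸ D)] (γ : G)
    (f : EuclideanSpace ℂ (G ⧸ D)) (q : G ⧸ D) : quasiRegularRep D γ f q = f (γ⁻¹ • q) := rfl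

variable {Γ : Subgroup (X ≃g X)}

/-- A function on the base of a covering gives, at each vertex of the total space, a function on
the cosets of the covering transformations. -/
def coveringLift (Γ : Subgroup (X ≃g X)) (p : V → W) (φ : W → ℂ) (x : V) :
    EuclideanSpace ℂ (Γ ⧸ (Cov X p).subgroupOf Γ) :=
  -- Changing the representative of the coset moves `γ⁻¹ • x` by a covering transformation, which
  -- `p` does not see.
  WithLp.toLp 2 fun q => Quotient.liftOn' q (fun γ : Γ => φ (p (γ⁻¹ • x))) fun a b hab => by
    rw [QuotientGroup.leftRel_apply, Subgroup.mem_subgroupOf] at hab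
    have h := congrFun (show p ∘ ((a⁻¹ * b : Γ) : X ≃g X) = p from hab) (b⁻¹ • x)
    have h2 : ((a⁻¹ * b : Γ) : X ≃g X) (b⁻¹ • x) = a⁻¹ • x := by
      change (a⁻¹ * b) • b⁻¹ • x = a⁻¹ • x
      rw [mul_smul, smul_inv_smul]
    rw [Function.comp_apply, h2] at h
    rw [h]

theorem coveringLift_mk (φ : W → ℂ) (x : V) (γ : Γ) :
    coveringLift Γ p φ x (γ : Γ ⧸ (Cov X p).subgroupOf Γ) = φ (p (γ⁻¹ • x)) := rfl

variable [Fintype (Γ ⧸ (Cov X p).subgroupOf Γ)]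

theorem coveringLift_mem (φ : W → ℂ) :
    coveringLift Γ p φ ∈ equivariantFunctions Γ (quasiRegularRep ((Cov X p).subgroupOf Γ)) := by
  intro γ u
  ext q
  induction q using QuotientGroup.induction_on with
  | H δ =>
    rw [quasiRegularRep_apply, coveringLift_mk, MulAction.Quotient.smul_coe, coveringLift_mk,
      smul_eq_mul, mul_inv_rev, inv_inv, mul_smul]

/-- Eigenvalues of the Markov operator of the base of a covering occur upstairs. -/
theorem mem_spectrum_markovOperator [X.LocallyFinite] [Y.LocallyFinite]
    (hp : IsGraphCovering X Y p) (hps : Function.Surjective p) {k : ℕ} {φ : W → ℂ} (hφ : φ ≠ 0)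
    {t : ℂ} (ht : ∀ y, (1 / (k : ℂ)) * ∑ w ∈ Y.neighborFinset y, φ w = t * φ y) :
    t ∈ spectrum ℂ (markovOperator k Γ (quasiRegularRep ((Cov X p).subgroupOf Γ))) := by
  refine Module.End.HasEigenvalue.mem_spectrum
    (Module.End.hasEigenvalue_of_hasEigenvector (x := ⟨_, coveringLift_mem φ⟩) ⟨?_, ?_⟩)
  · rw [Module.End.mem_eigenspace_iff]
    ext x q
    induction q using QuotientGroup.induction_on with
    | H γ =>
      rw [markovOperator_apply]
      change (1 / (k : ℂ)) * (∑ v ∈ X.neighborFinset x, coveringLift Γ p φ v) γ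
        = t * coveringLift Γ p φ x γ
      rw [coveringLift_mk, ← ht, ← hp.sum_neighborFinset, sum_neighbors_smul]
      congr 1
      simp [coveringLift_mk]
  -- The lift is nonzero: its coordinate at the trivial coset is `φ (p x)`, and `p` is onto.
  · intro h
    apply hφ
    funext y
    obtain ⟨x, rfl⟩ := hps y
    have h1 := congrFun (congrArg Subtype.val h) x
    have h2 : coveringLift Γ p φ x ((1 : Γ) : Γ ⧸ (Cov X p).subgroupOf Γ) = 0 := by
      change coveringLift Γ p φ x = 0 at h1
      rw [h1]; rfl
    rwa [coveringLift_mk, inv_one, one_smul] at h2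

end Lift

/-- Finite index makes the coset space finite, so its `ℓ²` is a Hilbert space containing every
function on cosets. It lies in the universe of `V`, as `IsKazhdanConstant` demands, whatever the
universe of `W`. -/
theorem IsKazhdanConstant.eigenvalue_le_or_eq_one {V : Type u} {X : SimpleGraph V}
    [X.LocallyFinite] {W : Type v} {Y : SimpleGraph W} [Y.LocallyFinite] {p : V → W}
    {Γ : Subgroup (X ≃g X)} {k : ℕ} {σ : ℝ} (hσ : IsKazhdanConstant X k Γ σ) [Nonempty V]
    (hY : Y.Connected) (hp : IsGraphCovering X Y p) (hfi : ((Cov X p).subgroupOf Γ).FiniteIndex)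
    {φ : W → ℝ} (hφ : φ ≠ 0) {t : ℝ}
    (ht : ∀ y, (1 / (k : ℝ)) * ∑ w ∈ Y.neighborFinset y, φ w = t * φ y) : t ≤ σ ∨ t = 1 := by
  have := Fintype.ofFinite (Γ ⧸ (Cov X p).subgroupOf Γ)
  have hmem := hσ.2 _ (quasiRegularRep ((Cov X p).subgroupOf Γ))
    (mem_spectrum_markovOperator (Γ := Γ) (k := k) (φ := fun w => (φ w : ℂ)) (t := t) hp
      (hp.surjective hY) ?_ ?_)
  · obtain ⟨s, hs, hst⟩ := hmem
    obtain rfl := Complex.ofReal_injective hst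
    exact hs.imp (fun h => h.2) id
  · intro h
    exact hφ (funext fun y => Complex.ofReal_injective (congrFun h y))
  · intro y
    have := congrArg Complex.ofReal (ht y)
    push_cast at this
    exact this

/-! ### From the spectral gap to expansion -/

section Expansion

theorem eq_of_forall_adj_eq {W α : Type*} {Y : SimpleGraph W} (hY : Y.Connected) {φ : W → α}
    (h : ∀ y w, Y.Adj y w → φ y = φ w) (y w : W) : φ y = φ w := by
  obtain ⟨q⟩ := hY.preconnected y w
  induction q with
  | nil => rfl
  | cons hadj _ ih => exact (h _ _ hadj).trans ih

variable {W : Type v} {Y : SimpleGraph W} [Y.LocallyFinite]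

variable (Y) in
/-- The averaging operator of a finite graph on `ℓ²(W)`. -/
def averagingOperator (k : ℕ) : EuclideanSpace ℝ W →ₗ[ℝ] EuclideanSpace ℝ W where
  toFun φ := WithLp.toLp 2 fun y => (1 / (k : ℝ)) * ∑ w ∈ Y.neighborFinset y, φ w
  map_add' φ ψ := by ext y; simp [Finset.sum_add_distrib, mul_add]
  map_smul' c φ := by ext y; simp [← Finset.mul_sum, mul_left_comm]

theorem averagingOperator_apply (k : ℕ) (φ : EuclideanSpace ℝ W) (y : W) :
    averagingOperator Y k φ y = (1 / (k : ℝ)) * ∑ w ∈ Y.neighborFinset y, φ w := rfl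

variable [Fintype W]

theorem sum_sum_neighbor_swap {R : Type*} [AddCommMonoid R] (a : W → W → R) :
    ∑ y, ∑ w ∈ Y.neighborFinset y, a y w = ∑ y, ∑ w ∈ Y.neighborFinset y, a w y :=
  Finset.sum_comm' fun y w => by simp [Y.adj_comm]

theorem inner_averagingOperator (k : ℕ) (φ ψ : EuclideanSpace ℝ W) :
    ⟪averagingOperator Y k φ, ψ⟫_ℝ
      = (1 / (k : ℝ)) * ∑ y, ∑ w ∈ Y.neighborFinset y, φ w * ψ y := by
  rw [PiLp.inner_apply, Finset.mul_sum]
  refine Finset.sum_congr rfl fun y _ => ?_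
  rw [averagingOperator_apply, ← Finset.sum_mul]
  simp only [RCLike.inner_apply, conj_trivial]
  ring

theorem averagingOperator_isSymmetric (k : ℕ) : (averagingOperator Y k).IsSymmetric := by
  intro φ ψ
  rw [real_inner_comm _ φ, inner_averagingOperator, inner_averagingOperator,
    sum_sum_neighbor_swap]
  simp only [mul_comm]

theorem sum_sum_sub_sq {k : ℕ} (hk : k ≠ 0) (hreg : Y.IsRegularOfDegree k)
    (φ : EuclideanSpace ℝ W) :
    ∑ y, ∑ w ∈ Y.neighborFinset y, (φ y - φ w) ^ 2
      = 2 * k * (‖φ‖ ^ 2 - ⟪averagingOperator Y k φ, φ⟫_ℝ) := by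
  have hk' : (k : ℝ) ≠ 0 := Nat.cast_ne_zero.2 hk
  have hsq : ‖φ‖ ^ 2 = ∑ y, φ y ^ 2 := by
    rw [EuclideanSpace.norm_sq_eq]
    simp
  have hout : ∑ y, ∑ _w ∈ Y.neighborFinset y, φ y ^ 2 = k * ‖φ‖ ^ 2 := by
    rw [hsq, Finset.mul_sum]
    refine Finset.sum_congr rfl fun y _ => ?_
    rw [Finset.sum_const, Y.card_neighborFinset_eq_degree, hreg y, nsmul_eq_mul]
  have hin : ∑ y, ∑ w ∈ Y.neighborFinset y, φ w ^ 2 = k * ‖φ‖ ^ 2 := by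
    rw [← hout, sum_sum_neighbor_swap]
  have hexp : ∀ y w, (φ y - φ w) ^ 2 = φ y ^ 2 + φ w ^ 2 - 2 * (φ w * φ y) := fun y w => by ring
  simp_rw [hexp, Finset.sum_sub_distrib, Finset.sum_add_distrib, ← Finset.mul_sum]
  rw [hout, hin, inner_averagingOperator]
  field_simp
  ring

/-- If all eigenvalues of the averaging operator other than `1` are at most `σ`, then functions of
mean zero satisfy the corresponding Poincaré inequality. -/
theorem poincare_of_eigenvalue_le (hY : Y.Connected) {k : ℕ} (hk : k ≠ 0)
    (hreg : Y.IsRegularOfDegree k) {σ : ℝ}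
    (heig : ∀ (φ : W → ℝ) (t : ℝ), φ ≠ 0 →
      (∀ y, (1 / (k : ℝ)) * ∑ w ∈ Y.neighborFinset y, φ w = t * φ y) → t ≤ σ ∨ t = 1)
    (φ : W → ℝ) (hφ : ∑ y, φ y = 0) :
    2 * k * ((1 - σ) * ∑ y, φ y ^ 2) ≤ ∑ y, ∑ w ∈ Y.neighborFinset y, (φ y - φ w) ^ 2 := by
  set f : EuclideanSpace ℝ W := WithLp.toLp 2 φ with hf
  have hT := averagingOperator_isSymmetric (Y := Y) k
  set T := averagingOperator Y k with hTdef
  set b := hT.eigenvectorBasis (rfl : Module.finrank ℝ (EuclideanSpace ℝ W) = _) with hb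
  set l := hT.eigenvalues (rfl : Module.finrank ℝ (EuclideanSpace ℝ W) = _) with hl
  have hTb : ∀ i, T (b i) = l i • b i := fun i => hT.apply_eigenvectorBasis rfl i
  -- Compare both sides term by term in an orthonormal eigenbasis.
  have hle : ⟪T f, f⟫_ℝ ≤ σ * ‖f‖ ^ 2 := by
    rw [← real_inner_self_eq_norm_sq, ← b.sum_inner_mul_inner (T f) f, ← b.sum_inner_mul_inner f f,
      Finset.mul_sum]
    refine Finset.sum_le_sum fun i _ => ?_
    rw [hT f (b i), hTb, inner_smul_right, real_inner_comm f (b i), mul_assoc]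
    have hne : ((b i : EuclideanSpace ℝ W) : W → ℝ) ≠ 0 := fun h => by
      refine b.toBasis.ne_zero i ?_
      rw [OrthonormalBasis.coe_toBasis]
      ext y
      exact congrFun h y
    rcases heig (b i) (l i) hne
      fun y => congrArg (fun g : EuclideanSpace ℝ W => g y) (hTb i) with h | h
    · exact mul_le_mul_of_nonneg_right h (mul_self_nonneg _)
    -- An eigenfunction with eigenvalue `1` has zero Dirichlet energy, so it is constant on the
    -- connected graph and orthogonal to the mean-zero `f`.
    · have hconst : ∀ y w, (b i) y = (b i) w := by
        refine eq_of_forall_adj_eq hY fun y w hyw => ?_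
        have h0 := sum_sum_sub_sq hk hreg (b i)
        rw [← hTdef, hTb, h, one_smul, real_inner_self_eq_norm_sq, sub_self, mul_zero] at h0
        have h1 := (Finset.sum_eq_zero_iff_of_nonneg
          fun y _ => Finset.sum_nonneg fun w _ => sq_nonneg _).1 h0 y (Finset.mem_univ y)
        have h2 := (Finset.sum_eq_zero_iff_of_nonneg fun w _ => sq_nonneg _).1 h1 w
          ((Y.mem_neighborFinset _ _).2 hyw)
        exact sub_eq_zero.1 (pow_eq_zero_iff two_ne_zero |>.1 h2)
      obtain ⟨y₀⟩ := hY.nonempty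
      have h0 : ⟪f, b i⟫_ℝ = 0 := by
        rw [PiLp.inner_apply]
        simp only [RCLike.inner_apply, conj_trivial, hconst _ y₀]
        rw [← Finset.mul_sum]
        exact mul_eq_zero_of_right _ hφ
      rw [h0]
      simp
  have hsq : ‖f‖ ^ 2 = ∑ y, φ y ^ 2 := by
    rw [EuclideanSpace.norm_sq_eq]
    simp [hf]
  have hD := sum_sum_sub_sq hk hreg f
  change ∑ y, ∑ w ∈ Y.neighborFinset y, (φ y - φ w) ^ 2 = _ at hD
  rw [hD, ← hsq]
  refine mul_le_mul_of_nonneg_left ?_ (by positivity)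
  linarith

-- Only edges between `A` and its complement contribute, once in each direction. The endpoint
-- outside `A` lies in `∂A`, and each vertex there meets at most `k` such edges.
open Classical in
theorem sum_sum_indicator_sub_sq_le {k : ℕ} (hreg : Y.IsRegularOfDegree k) (A : Finset W)
    (a : ℝ) :
    ∑ y, ∑ w ∈ Y.neighborFinset y,
        (((if y ∈ A then 1 else 0) - a) - ((if w ∈ A then 1 else 0) - a)) ^ 2
      ≤ 2 * k * ((boundary Y A).card : ℝ) := by
  have hexp : ∀ y w : W, (((if y ∈ A then (1 : ℝ) else 0) - a) - ((if w ∈ A then 1 else 0) - a)) ^ 2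
      = (if y ∉ A ∧ w ∈ A then 1 else 0) + (if w ∉ A ∧ y ∈ A then 1 else 0) := by
    intro y w
    by_cases hy : y ∈ A <;> by_cases hw : w ∈ A <;>
      simp only [hy, hw, if_true, if_false, not_true_eq_false, not_false_eq_true, and_self, and_true,
        and_false] <;> ring
  simp_rw [hexp, Finset.sum_add_distrib]
  rw [← sum_sum_neighbor_swap (fun y w => if y ∉ A ∧ w ∈ A then (1 : ℝ) else 0), ← two_mul,
    mul_assoc]
  refine mul_le_mul_of_nonneg_left ?_ zero_le_two
  calc ∑ y, ∑ w ∈ Y.neighborFinset y, (if y ∉ A ∧ w ∈ A then (1 : ℝ) else 0)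
      ≤ ∑ y, if y ∈ boundary Y A then (k : ℝ) else 0 := by
        refine Finset.sum_le_sum fun y _ => ?_
        split_ifs with hy
        · refine (Finset.sum_le_card_nsmul _ _ 1 fun w _ => ?_).trans ?_
          · split_ifs <;> norm_num
          · rw [Y.card_neighborFinset_eq_degree, hreg y, nsmul_eq_mul, mul_one]
        · refine le_of_eq (Finset.sum_eq_zero fun w hw => if_neg fun h => hy ?_)
          rw [boundary, Finset.mem_filter]
          exact ⟨Finset.mem_univ y, h.1, w, h.2, ((Y.mem_neighborFinset _ _).1 hw).symm⟩
    _ = k * ((boundary Y A).card : ℝ) := by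
        rw [← Finset.sum_filter, Finset.sum_const, nsmul_eq_mul, mul_comm]
        simp

-- The test function is the indicator of `A` minus its mean `a = |A|/n`, with squared norm `(1 -
-- a)|A|`. The factor `2k` occurs on both sides and cancels, which is why the constant does not
-- depend on `k`.
open Classical in
theorem isExpander_of_eigenvalue_le (hY : Y.Connected) {k : ℕ} (hk : k ≠ 0)
    (hreg : Y.IsRegularOfDegree k) {σ : ℝ}
    (heig : ∀ (φ : W → ℝ) (t : ℝ), φ ≠ 0 →
      (∀ y, (1 / (k : ℝ)) * ∑ w ∈ Y.neighborFinset y, φ w = t * φ y) → t ≤ σ ∨ t = 1) :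
    IsExpander Y (Fintype.card W) k (1 - σ) := by
  refine ⟨rfl, hreg, fun A => ?_⟩
  have := hY.nonempty
  have hn : (Fintype.card W : ℝ) ≠ 0 := Nat.cast_ne_zero.2 Fintype.card_ne_zero
  set a : ℝ := A.card / Fintype.card W with ha
  have hna : (Fintype.card W : ℝ) * a = A.card := mul_div_cancel₀ _ hn
  have hA : ∑ y, (if y ∈ A then (1 : ℝ) else 0) = A.card := by simp
  have hmean : ∑ y, ((if y ∈ A then (1 : ℝ) else 0) - a) = 0 := by
    rw [Finset.sum_sub_distrib, hA, Finset.sum_const, Finset.card_univ, nsmul_eq_mul, hna,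
      sub_self]
  have hsq : ∑ y, ((if y ∈ A then (1 : ℝ) else 0) - a) ^ 2 = (1 - a) * A.card := by
    have h1 : ∀ y, ((if y ∈ A then (1 : ℝ) else 0) - a) ^ 2
        = (1 - 2 * a) * (if y ∈ A then (1 : ℝ) else 0) + a ^ 2 := by
      intro y
      split_ifs <;> ring
    simp_rw [h1]
    rw [Finset.sum_add_distrib, ← Finset.mul_sum, hA, Finset.sum_const, Finset.card_univ,
      nsmul_eq_mul, pow_two, ← mul_assoc, hna]
    ring
  have h := (poincare_of_eigenvalue_le hY hk hreg heig _ hmean).trans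
    (sum_sum_indicator_sub_sq_le hreg A a)
  rw [hsq] at h
  have hkpos : (0 : ℝ) < k := by exact_mod_cast Nat.pos_of_ne_zero hk
  rw [mul_assoc]
  exact le_of_mul_le_mul_left h (by positivity)

/-- A connected graph without edges is a single vertex, so `A` is empty or everything and the lower
bound vanishes for any `c`. -/
theorem isExpander_of_isRegularOfDegree_zero (hY : Y.Connected) (hreg : Y.IsRegularOfDegree 0)
    (c : ℝ) : IsExpander Y (Fintype.card W) 0 c := by
  refine ⟨rfl, hreg, fun A => ?_⟩
  have := hY.nonempty
  have hsub : Subsingleton W := ⟨eq_of_forall_adj_eq hY (φ := id) fun y w hyw => by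
    have h : Y.neighborFinset y = ∅ := by
      rw [← Finset.card_eq_zero, Y.card_neighborFinset_eq_degree, hreg y]
    have := (Y.mem_neighborFinset y w).2 hyw
    simp [h] at this⟩
  have hn : (Fintype.card W : ℝ) ≠ 0 := Nat.cast_ne_zero.2 Fintype.card_ne_zero
  rcases A.eq_empty_or_nonempty with rfl | ⟨x, hx⟩
  · simp
  · have hA : A = Finset.univ := Finset.eq_univ_of_forall fun y => Subsingleton.elim x y ▸ hx
    rw [hA, Finset.card_univ, div_self hn]
    simp

end Expansion

end KazhdanGraph
end

open KazhdanGraph in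
theorem theorem3p1 :
    ∃ c : ℝ → ℝ, (∀ σ : ℝ, σ < 1 → 0 < c σ) ∧
      ∀ {V : Type*} (X : SimpleGraph V) [X.LocallyFinite] (k : ℕ) (Γ : Subgroup (X ≃g X)),
        X.Connected → X.IsRegularOfDegree k → IsKazhdanGraphStructure X Γ →
        (∃ σ : ℝ, IsKazhdanConstant X k Γ σ) ∧
        ∀ σ : ℝ, IsKazhdanConstant X k Γ σ →
          ∀ {ι : Type*} (W : ι → Type*) [∀ i, Fintype (W i)]
            (Y : ∀ i, SimpleGraph (W i)) [∀ i, (Y i).LocallyFinite] (p : ∀ i, V → W i),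
            (∀ i, (Y i).Connected) →
            (∀ i, (Y i).IsRegularOfDegree k) →
            (∀ i, IsGraphCovering X (Y i) (p i)) →
            (∀ i, Γ ≤ Cov X (p i) ∨
              (Cov X (p i) ≤ Γ ∧ ((Cov X (p i)).subgroupOf Γ).FiniteIndex)) →
            IsExpanderFamily Y k (c σ) := by
  refine ⟨fun σ => 1 - σ, fun σ hσ => sub_pos.2 hσ, ?_⟩
  intro V X _ k Γ hX hreg hΓ
  refine ⟨exists_isKazhdanConstant X hX hreg hΓ, ?_⟩
  intro σ hσ ι W _ Y _ p hY hYreg hp hcov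
  refine ⟨sub_pos.2 hσ.1, fun i => ?_⟩
  have := hX.nonempty
  rcases eq_or_ne k 0 with rfl | hk
  · exact isExpander_of_isRegularOfDegree_zero (hY i) (hYreg i) _
  -- In case (i) the intersection of `Cov` with `Γ` is all of `Γ`, of index one; both cases are thus
  -- instances of finite index.
  · have hfi : ((Cov X (p i)).subgroupOf Γ).FiniteIndex := by
      rcases hcov i with h | h
      · rw [Subgroup.subgroupOf_eq_top.2 h]
        infer_instance
      · exact h.2
    exact isExpander_of_eigenvalue_le (hY i) hk (hYreg i) fun φ t hφ ht =>
      hσ.eigenvalue_le_or_eq_one (hY i) (hp i) hfi hφ ht
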